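/- **Setting.** Let $n\ge 1$, and let the local Hilbert space have a finite orthonormal basis $|i\rangle$ labelled by $i$, each $i$ having a fermion parity $|i|\in\{0,1\}$. Consider families $A=\{A^i\}_i$ of complex $2n\times 2n$ matrices for which there is a grading matrix $Z$, unitarily equivalent to $\sigma_z\otimes 1_n$, with $(-1)^{|i|}A^i=ZA^iZ$ for all $i$. For a boundary matrix $\Omega$ put $$|A,\Omega\rangle_L=\sum_{i_1,\dots,i_L}\mathrm{tr}\,[\Omega A^{i_1}\cdots A^{i_L}]\;|i_1,\dots,i_L\rangle .$$ Such an $A$ is *injective with Wall invariant $(-)$* if there are unitary $W\in \mathrm U(2n)$, $n\times n$ matrices $B^i$ and a length $l$ such that $A^i=W(\sigma_x^{|i|}\otimes B^i)W^\dagger$ for all $i$ and such that both the products $B^{i_1}\cdots B^{i_l}$ with $\sum_k|i_k|$ even, and those with $\sum_k|i_k|$ odd, span $\mathrm M_n(\mathbb C)$. The matrix $u=W(\sigma_x\otimes 1_n)W^\dagger$ is then called a *Wall matrix* of $A$. $A$ is *in canonical form* if $\sum_iA^iA^{i\dagger}=1_{2n}$. Two families $A,\tilde A$ *give the same physical state in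 APBC* if for every $L\ge1$ there is a phase $e^{i\alpha_L}$ with $|A,1_{2n}\rangle_L=e^{i\alpha_L}|\tilde A,1_{2n}\rangle_L$, and *in PBC* if for every $L\ge 1$ there is a phase $e^{i\alpha_L}$ with $|A,u\rangle_L=e^{i\alpha_L}|\tilde A,\tilde u\rangle_L$, where $u,\tilde u$ are Wall matrices of $A,\tilde A$. **Theorem.** Let $A=\{A^i\}_i$ and $\tilde A=\{\tilde A^i\}_i$ be injective with Wall invariant $(-)$ and in canonical form, with the same $n$ and the same physical basis. 1. $A$ and $\tilde A$ give the same physical state in APBC if and only if there exist a unitary $V\in\mathrm U(2n)$ and a phase $e^{i\beta}\in\mathrm U(1)$ with $$\tilde A^i=e^{i\beta}V^\dagger A^iV\quad\text{for all } i.\qquad(*)$$ 2. The same equivalence holds with PBC in place of APBC, for any choice of Wall matrices $u,\tilde u$. 3. The phase $e^{i\beta}$ in $(*)$ is unique. 4. If $(V,e^{i\beta})$ satisfies $(*)$, then a unitary $V'$ satisfies $(*)$ with the same phase if and only if $V'=zV\tilde z$ for some unitary matrices $z,\tilde z$ in the centers of the algebras generated by $\{A^i\}_i$ and $\{\tilde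 A^i\}_i$, respectively. For any Wall matrices $u,\tilde u$, the unitary matrices in these centers are exactly the matrices $e^{i\alpha}e^{i\theta u}$, respectively $e^{i\alpha}e^{i\theta\tilde u}$, with $\alpha,\theta\in\mathbb R$. 5. For any Wall matrices $u$ of $A$ and $\tilde u$ of $\tilde A$ there is a sign $\eta\in\{\pm1\}$ such that $\tilde u=\eta V^\dagger uV$ for every $V$ satisfying $(*)$ for some phase. -/

import Mathlib

open scoped Matrix Kronecker

noncomputable section

namespace FMPS

/-- The Pauli matrix `σ_x`. -/
def pauliX : Matrix (Fin 2) (Fin 2) ℂ := !![0, 1; 1, 0]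

/-- The Pauli matrix `σ_z`. -/
def pauliZ : Matrix (Fin 2) (Fin 2) ℂ := !![1, 0; 0, -1]

/-- `2n × 2n` complex matrices, with rows and columns indexed so that `σ ⊗ b` is the
Kronecker product of a `2 × 2` matrix `σ` and an `n × n` matrix `b`. -/
abbrev BondMatrix (n : ℕ) : Type := Matrix (Fin 2 × Fin n) (Fin 2 × Fin n) ℂ

/-- The unitary group `U(2n)`. -/
abbrev BondUnitary (n : ℕ) : Type := Matrix.unitaryGroup (Fin 2 × Fin n) ℂ

section

variable {ι : Type*} {m : Type*} [Fintype m] [DecidableEq m]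

/-- The product `M^{i_1} ⋯ M^{i_L}` of the matrices labelled by the word `(i_1, …, i_L)`. -/
def wordProd (M : ι → Matrix m m ℂ) {L : ℕ} (w : Fin L → ι) : Matrix m m ℂ :=
  (List.ofFn fun k => M (w k)).prod

/-- The linear span of all products `M^{i_1} ⋯ M^{i_l}` of length exactly `l` with
`∑ k, |i_k| = ε` modulo 2, where `|i| = par i`. -/
def paritySpan (par : ι → ZMod 2) (M : ι → Matrix m m ℂ) (l : ℕ) (ε : ZMod 2) :
    Submodule ℂ (Matrix m m ℂ) :=
  Submodule.span ℂ {X | ∃ w : Fin l → ι, ∑ k, par (w k) = ε ∧ X = wordProd M w}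

/-- The many-body state `∑ tr[Ω M^{i_1} ⋯ M^{i_L}] |i_1, …, i_L⟩` on `L` sites, in the Hilbert space
with orthonormal basis `|i_1, …, i_L⟩`. -/
def mpsState (M : ι → Matrix m m ℂ) (Ω : Matrix m m ℂ) (L : ℕ) :
    EuclideanSpace ℂ (Fin L → ι) :=
  WithLp.toLp 2 fun w => (Ω * wordProd M w).trace

/-- The canonical form condition `∑ i, M^i M^{i†} = 1`. -/
def IsCanonical [Fintype ι] (M : ι → Matrix m m ℂ) : Prop :=
  ∑ i, M i * (M i)ᴴ = 1

/-- The unitary elements of the center of the algebra generated by the matrices `M^i`. -/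
def centralUnitaries (M : ι → Matrix m m ℂ) : Set (Matrix.unitaryGroup m ℂ) :=
  {z | (z : Matrix m m ℂ) ∈ Algebra.adjoin ℂ (Set.range M) ∧
    ∀ a ∈ Algebra.adjoin ℂ (Set.range M), (z : Matrix m m ℂ) * a = a * (z : Matrix m m ℂ)}

end

section

variable {ι : Type*} {n : ℕ}

/-- The space of fMPSs of bond dimension `2n`: there is a grading matrix `Z`, unitarily equivalent
to `σ_z ⊗ 1`, with `(-1)^{|i|} A^i = Z A^i Z`. -/
def IsFMPS (par : ι → ZMod 2) (A : ι → BondMatrix n) : Prop :=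
  ∃ Z : BondMatrix n,
    (∃ U : BondUnitary n, Z = (U : BondMatrix n)ᴴ * (pauliZ ⊗ₖ 1) * (U : BondMatrix n)) ∧
    ∀ i, (-1 : ℂ) ^ (par i).val • A i = Z * A i * Z

/-- `u` is a Wall matrix for `A` as an injective fMPS with Wall invariant `(-)`: one has
`u = W (σ_x ⊗ 1) W†` and `A^i = W (σ_x^{|i|} ⊗ B^i) W†` for a unitary `W` and `n × n` matrices `B^i`
such that, for one fixed length `l`, both the even and the odd products of `l` matrices `B^i`
span all `n × n` matrices. -/
def IsWallMatrix (par : ι → ZMod 2) (A : ι → BondMatrix n) (u : BondMatrix n) : Prop :=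
  ∃ W : BondUnitary n,
    u = (W : BondMatrix n) * (pauliX ⊗ₖ 1) * (W : BondMatrix n)ᴴ ∧
    ∃ B : ι → Matrix (Fin n) (Fin n) ℂ,
      (∀ i, A i = (W : BondMatrix n) * ((pauliX ^ (par i).val) ⊗ₖ B i) * (W : BondMatrix n)ᴴ) ∧
      ∃ l : ℕ, paritySpan par B l 0 = ⊤ ∧ paritySpan par B l 1 = ⊤

/-- Injective fMPS with Wall invariant `(-)`. -/
def IsInjectiveMinus (par : ι → ZMod 2) (A : ι → BondMatrix n) : Prop :=
  IsFMPS par A ∧ ∃ u : BondMatrix n, IsWallMatrix par A u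

/-- Two families with boundary matrices `Ω` and `Ω'` give the same physical state, with the same
norm, for every system size. -/
def SamePhysicalState (A : ι → BondMatrix n) (Ω : BondMatrix n)
    (A' : ι → BondMatrix n) (Ω' : BondMatrix n) : Prop :=
  ∀ L : ℕ, 1 ≤ L → ∃ α : Circle, mpsState A Ω L = (α : ℂ) • mpsState A' Ω' L

/-- Gauge equivalence of fMPSs, that is, equality of physical states under antiperiodic
boundary conditions (boundary matrix `1`). -/
def EquivAPBC (A A' : ι → BondMatrix n) : Prop :=
  SamePhysicalState A 1 A' 1

/-- Gauge equivalence under periodic boundary conditions: the boundary matrices are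
Wall matrices `u`, `u'` of the two families. -/
def EquivPBC (A A' : ι → BondMatrix n) (u u' : BondMatrix n) : Prop :=
  SamePhysicalState A u A' u'

/-- The relation `A'^i = c V† A^i V` for a phase `c = e^{iβ}` and a unitary `V`. -/
def GaugeRelated (A A' : ι → BondMatrix n) (c : Circle) (V : BondUnitary n) : Prop :=
  ∀ i, A' i = (c : ℂ) • ((V : BondMatrix n)ᴴ * A i * (V : BondMatrix n))

/-- The matrix `e^{iα} e^{iθu}`. -/
def phaseExp (α θ : ℝ) (u : BondMatrix n) : BondMatrix n :=
  Complex.exp (Complex.I * α) • NormedSpace.exp ((Complex.I * θ) • u)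

end

end FMPS

end

/-!
Conjugating by `W`, a family with Wall invariant `(-)` is `σ_x ^ |i| ⊗ B i`. The boundary matrix `1`
(antiperiodic) or the Wall matrix `u` (periodic) makes the trace over the first factor vanish unless
the word has even, respectively odd, parity, so equality of states says that, in each length `L`,
the words of one parity `κ` in the `B i` and in the `B' i` have the same traces up to a phase.

The direct implications thus rest on a fundamental theorem for words of one parity,
`exists_unitary_of_trace_wordProd`. Since the trace form is nondegenerate, equal traces of products
force the same linear relations among words of each large length and each parity. So there are
linear isomorphisms `φ a ε` of `M_n(ℂ)` taking words of length `a` and parity `ε` in the `B i` to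
those in the `B' i` (`exists_equiv_pairSpan_eq_graph`), and they are multiplicative in the graded
sense `φ a ε X * φ b δ Y = φ (a + b) (ε + δ) (X * Y)`. Each `φ a ε 1` is then central, so all
`φ a ε` are multiples of a single algebra automorphism, which is inner; comparing words that differ
by one letter yields `B' i = r s ^ |i| G B i G⁻¹` with `s = ±1`
(`exists_similarity_of_pairSpan_eq_graph`). Nonzero traces give `|r| = 1`. Under the canonical form,
`(Gᴴ G)⁻¹` is a fixed point of the unital map `X ↦ ∑ B i X (B i)ᴴ`, which by injectivity has only
scalar Hermitian fixed points (`exists_smul_one_of_isHermitian_of_fixed`); so `G` is unitary up to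
a scalar. Conjugation by `σ_z ⊗ 1` absorbs the sign `s`.

The remaining claims follow from the fact that the commutant of the family is spanned by `1` and `u`
(`IsWallMatrix.exists_eq_of_forall_commute`), where `u` is a traceless Hermitian involution in the
generated algebra: the only traceless involutions in this span are `±u`, its unitaries are the
`e^{iα} e^{iθu}`, and any two gauge transformations with the same phase differ by one of these.
The phase is unique because `1` lies in the span of the even words of every large length.
-/

namespace FMPS

/-! ### Words in the matrices and their spans -/

section Words

variable {ι : Type*} {m : Type*} [Fintype m] [DecidableEq m]

theorem wordProd_append (M : ι → Matrix m m ℂ) {a b : ℕ} (v : Fin a → ι) (w : Fin b → ι) :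
    wordProd M (Fin.append v w) = wordProd M v * wordProd M w := by
  have h : (fun k => M (Fin.append v w k)) = Fin.append (fun k => M (v k)) (fun k => M (w k)) := by
    funext k
    refine Fin.addCases (fun i => ?_) (fun i => ?_) k <;> simp
  rw [wordProd, h, List.ofFn_fin_append, List.prod_append]
  rfl

theorem wordProd_succ (M : ι → Matrix m m ℂ) {a : ℕ} (w : Fin (a + 1) → ι) :
    wordProd M w = M (w 0) * wordProd M (fun k => w k.succ) := by
  simp [wordProd, List.ofFn_succ]

theorem wordProd_zero (M : ι → Matrix m m ℂ) (w : Fin 0 → ι) : wordProd M w = 1 := by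
  simp [wordProd]

theorem wordProd_one (M : ι → Matrix m m ℂ) (i : ι) : wordProd M (fun _ : Fin 1 => i) = M i := by
  simp [wordProd]

theorem sum_append (par : ι → ZMod 2) {a b : ℕ} (v : Fin a → ι) (w : Fin b → ι) :
    ∑ k, par (Fin.append v w k) = ∑ k, par (v k) + ∑ k, par (w k) := by
  simp [Fin.sum_univ_add]

theorem wordProd_mem_paritySpan (par : ι → ZMod 2) (M : ι → Matrix m m ℂ) {l : ℕ}
    (w : Fin l → ι) : wordProd M w ∈ paritySpan par M l (∑ k, par (w k)) :=
  Submodule.subset_span ⟨w, rfl, rfl⟩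

theorem mem_paritySpan_one (par : ι → ZMod 2) (M : ι → Matrix m m ℂ) (i : ι) :
    M i ∈ paritySpan par M 1 (par i) :=
  Submodule.subset_span ⟨fun _ => i, by simp, (wordProd_one M i).symm⟩

theorem mul_mem_paritySpan {par : ι → ZMod 2} {M : ι → Matrix m m ℂ} {a b : ℕ} {ε δ : ZMod 2}
    {X Y : Matrix m m ℂ} (hX : X ∈ paritySpan par M a ε) (hY : Y ∈ paritySpan par M b δ) :
    X * Y ∈ paritySpan par M (a + b) (ε + δ) := by
  have h := Submodule.mul_mem_mul hX hY
  rw [paritySpan, paritySpan, Submodule.span_mul_span] at h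
  refine Submodule.span_mono ?_ h
  rintro _ ⟨_, ⟨v, rfl, rfl⟩, _, ⟨w, rfl, rfl⟩, rfl⟩
  exact ⟨Fin.append v w, sum_append par v w, (wordProd_append M v w).symm⟩

/-- If the words of length `l` span all matrices in both parities, then so do those of length
`l + 1`: splitting off the first letter of a word, the remaining factor can be rewritten in
terms of words that are longer by one letter. The length `0` is excluded since there is no odd
empty word. -/
theorem paritySpan_succ_eq_top [Nonempty m] {par : ι → ZMod 2} {M : ι → Matrix m m ℂ} {l : ℕ}
    (h : ∀ ε, paritySpan par M l ε = ⊤) (ε : ZMod 2) : paritySpan par M (l + 1) ε = ⊤ := by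
  obtain _ | k := l
  · have h1 : paritySpan par M 0 1 = ⊥ := by
      rw [paritySpan, Submodule.span_eq_bot]
      rintro _ ⟨w, hw, -⟩
      simp at hw
    exact absurd (h1.symm.trans (h 1)) bot_ne_top
  · rw [eq_top_iff, ← h ε, paritySpan, Submodule.span_le]
    rintro _ ⟨w, rfl, rfl⟩
    have h1 := mul_mem_paritySpan (mem_paritySpan_one par M (w 0))
      (show wordProd M (fun j => w j.succ) ∈
        paritySpan par M (k + 1) (∑ j : Fin k, par (w j.succ)) from h _ ▸ Submodule.mem_top)
    rw [← wordProd_succ, ← Fin.sum_univ_succ (fun j => par (w j)), add_comm 1] at h1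
    exact h1

theorem paritySpan_eq_top_of_le [Nonempty m] {par : ι → ZMod 2} {M : ι → Matrix m m ℂ} {l a : ℕ}
    (h : ∀ ε, paritySpan par M l ε = ⊤) (hla : l ≤ a) (ε : ZMod 2) :
    paritySpan par M a ε = ⊤ := by
  induction a, hla using Nat.le_induction generalizing ε with
  | base => exact h ε
  | succ a _ ih => exact paritySpan_succ_eq_top ih ε

/-- A matrix that commutes with all the generators `M i` commutes with all words. -/
theorem commute_of_mem_paritySpan {par : ι → ZMod 2} {M : ι → Matrix m m ℂ} {X : Matrix m m ℂ}
    (hX : ∀ i, Commute X (M i)) {l : ℕ} {ε : ZMod 2} {Y : Matrix m m ℂ}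
    (hY : Y ∈ paritySpan par M l ε) : Commute X Y := by
  refine Submodule.span_induction ?_ (Commute.zero_right X) (fun _ _ _ _ h₁ h₂ => h₁.add_right h₂)
    (fun c _ _ h => h.smul_right c) hY
  rintro _ ⟨w, -, rfl⟩
  refine Commute.list_prod_right _ _ fun Y hY => ?_
  obtain ⟨k, rfl⟩ := List.mem_ofFn.1 hY
  exact hX _

theorem mem_adjoin_of_mem_paritySpan {par : ι → ZMod 2} {M : ι → Matrix m m ℂ} {l : ℕ}
    {ε : ZMod 2} {Y : Matrix m m ℂ} (hY : Y ∈ paritySpan par M l ε) :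
    Y ∈ Algebra.adjoin ℂ (Set.range M) := by
  refine Submodule.span_le (p := Subalgebra.toSubmodule (Algebra.adjoin ℂ (Set.range M))).2 ?_ hY
  rintro _ ⟨w, -, rfl⟩
  refine Subalgebra.list_prod_mem _ fun Y hY => ?_
  obtain ⟨k, rfl⟩ := List.mem_ofFn.1 hY
  exact Algebra.subset_adjoin ⟨_, rfl⟩

theorem exists_smul_one_of_forall_commute {X : Matrix m m ℂ} (h : ∀ Y : Matrix m m ℂ, Commute X Y) :
    ∃ c : ℂ, X = c • 1 := by
  obtain ⟨c, hc⟩ := Matrix.mem_range_scalar_iff_commute_single'.2 fun i j => (h _).symm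
  exact ⟨c, by rw [← hc, Matrix.scalar_apply, Matrix.smul_one_eq_diagonal]⟩

/-- Every algebra automorphism of a full matrix algebra is inner. -/
theorem exists_units_conj (f : Matrix m m ℂ ≃ₐ[ℂ] Matrix m m ℂ) :
    ∃ G : (Matrix m m ℂ)ˣ, ∀ X, f X = G * X * (G⁻¹ : (Matrix m m ℂ)ˣ) := by
  obtain ⟨T, hT⟩ := ((Matrix.toLinAlgEquiv'.symm.trans f).trans
    Matrix.toLinAlgEquiv').eq_linearEquivConjAlgEquiv
  refine ⟨⟨LinearMap.toMatrixAlgEquiv' T.toLinearMap, LinearMap.toMatrixAlgEquiv' T.symm.toLinearMap,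
    ?_, ?_⟩, fun X => ?_⟩
  · rw [← map_mul]
    simp [Module.End.mul_eq_comp]
  · rw [← map_mul]
    simp [Module.End.mul_eq_comp]
  · have h := congrArg LinearMap.toMatrixAlgEquiv' (DFunLike.congr_fun hT (Matrix.toLinAlgEquiv' X))
    simp only [LinearEquiv.conjAlgEquiv_apply] at h
    rw [← Module.End.mul_eq_comp, ← Module.End.mul_eq_comp, map_mul, map_mul] at h
    simpa [mul_assoc] using h

end Words

/-! ### The correspondence of words defined by equal traces -/

open scoped ComplexOrder in
theorem eq_zero_of_forall_trace_mul {m : Type*} [Fintype m] {X : Matrix m m ℂ}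
    (h : ∀ Y : Matrix m m ℂ, (X * Y).trace = 0) : X = 0 :=
  Matrix.trace_mul_conjTranspose_self_eq_zero_iff.1 (h Xᴴ)

section Pairs

variable {ι : Type*} {m : Type*} [Fintype m] [DecidableEq m]

/-- The span of the pairs `(M^{i_1} ⋯ M^{i_l}, M'^{i_1} ⋯ M'^{i_l})` over the words of length `l`
and parity `ε`. When it is the graph of a linear map, that map sends each word in the `M i` to the
same word in the `M' i`. -/
noncomputable def pairSpan (par : ι → ZMod 2) (M M' : ι → Matrix m m ℂ) (l : ℕ) (ε : ZMod 2) :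
    Submodule ℂ (Matrix m m ℂ × Matrix m m ℂ) :=
  Submodule.span ℂ {p | ∃ w : Fin l → ι, ∑ k, par (w k) = ε ∧ p = (wordProd M w, wordProd M' w)}

variable {par : ι → ZMod 2} {M M' : ι → Matrix m m ℂ}

theorem map_fst_pairSpan (l : ℕ) (ε : ZMod 2) :
    (pairSpan par M M' l ε).map (LinearMap.fst ℂ _ _) = paritySpan par M l ε := by
  rw [pairSpan, Submodule.map_span, paritySpan]
  congr 1
  ext X
  constructor
  · rintro ⟨_, ⟨w, hw, rfl⟩, rfl⟩
    exact ⟨w, hw, rfl⟩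
  · rintro ⟨w, hw, rfl⟩
    exact ⟨_, ⟨w, hw, rfl⟩, rfl⟩

theorem map_snd_pairSpan (l : ℕ) (ε : ZMod 2) :
    (pairSpan par M M' l ε).map (LinearMap.snd ℂ _ _) = paritySpan par M' l ε := by
  rw [pairSpan, Submodule.map_span, paritySpan]
  congr 1
  ext X
  constructor
  · rintro ⟨_, ⟨w, hw, rfl⟩, rfl⟩
    exact ⟨w, hw, rfl⟩
  · rintro ⟨w, hw, rfl⟩
    exact ⟨_, ⟨w, hw, rfl⟩, rfl⟩

theorem mul_mem_pairSpan {a b : ℕ} {ε δ : ZMod 2} {p q : Matrix m m ℂ × Matrix m m ℂ}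
    (hp : p ∈ pairSpan par M M' a ε) (hq : q ∈ pairSpan par M M' b δ) :
    p * q ∈ pairSpan par M M' (a + b) (ε + δ) := by
  have h := Submodule.mul_mem_mul hp hq
  rw [pairSpan, pairSpan, Submodule.span_mul_span] at h
  refine Submodule.span_mono ?_ h
  rintro _ ⟨_, ⟨v, rfl, rfl⟩, _, ⟨w, rfl, rfl⟩, rfl⟩
  exact ⟨Fin.append v w, sum_append par v w,
    by simp only [wordProd_append, Prod.mk_mul_mk]⟩

theorem mem_pairSpan_one (par : ι → ZMod 2) (M M' : ι → Matrix m m ℂ) (i : ι) :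
    (M i, M' i) ∈ pairSpan par M M' 1 (par i) :=
  Submodule.subset_span ⟨fun _ => i, by simp, by simp only [wordProd_one]⟩

theorem trace_eq_of_mem_pairSpan {l : ℕ} {ε : ZMod 2} {α : ℂ}
    (h : ∀ w : Fin l → ι, ∑ k, par (w k) = ε →
      (wordProd M w).trace = α * (wordProd M' w).trace)
    {p : Matrix m m ℂ × Matrix m m ℂ} (hp : p ∈ pairSpan par M M' l ε) :
    p.1.trace = α * p.2.trace := by
  refine Submodule.span_induction ?_ (by simp) (fun x y _ _ hx hy => ?_) (fun c x _ hx => ?_) hp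
  · rintro _ ⟨w, hw, rfl⟩
    exact h w hw
  · simp [hx, hy, mul_add]
  · simp [hx, mul_left_comm]

/-- If words of a length and parity have proportional traces, and they are products of two spanning
sets of shorter words, then the linear relations among the shorter words in the `M i` and in the
`M' i` are the same, because the trace form is nondegenerate. So the shorter words correspond by
a linear isomorphism. -/
theorem exists_equiv_pairSpan_eq_graph {a b : ℕ} {ε δ : ZMod 2} {α : ℂ} (hα : α ≠ 0)
    (ha : paritySpan par M a ε = ⊤) (ha' : paritySpan par M' a ε = ⊤)
    (hb : paritySpan par M b δ = ⊤) (hb' : paritySpan par M' b δ = ⊤)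
    (h : ∀ w : Fin (a + b) → ι, ∑ k, par (w k) = ε + δ →
      (wordProd M w).trace = α * (wordProd M' w).trace) :
    ∃ e : Matrix m m ℂ ≃ₗ[ℂ] Matrix m m ℂ, pairSpan par M M' a ε = e.toLinearMap.graph := by
  have key : ∀ p ∈ pairSpan par M M' a ε, ∀ q ∈ pairSpan par M M' b δ,
      (p.1 * q.1).trace = α * (p.2 * q.2).trace := fun p hp q hq =>
    trace_eq_of_mem_pairSpan h (mul_mem_pairSpan hp hq)
  rw [← map_fst_pairSpan (M' := M'), Submodule.eq_top_iff'] at ha hb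
  rw [← map_snd_pairSpan (M := M), Submodule.eq_top_iff'] at ha' hb'
  refine Submodule.exists_equiv_eq_graph ⟨?_, fun X => ?_⟩ ⟨?_, fun X => ?_⟩
  · refine (injective_iff_map_eq_zero ((LinearMap.fst ℂ _ _).comp
      (pairSpan par M M' a ε).subtype)).2 ?_
    rintro ⟨⟨X, X'⟩, hp⟩ (rfl : X = 0)
    have : X' = 0 := eq_zero_of_forall_trace_mul fun Y => by
      obtain ⟨q, hq, rfl⟩ := hb' Y
      simpa [hα] using (key _ hp q hq).symm
    subst this
    rfl
  · obtain ⟨p, hp, rfl⟩ := ha X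
    exact ⟨⟨p, hp⟩, rfl⟩
  · refine (injective_iff_map_eq_zero ((LinearMap.snd ℂ _ _).comp
      (pairSpan par M M' a ε).subtype)).2 ?_
    rintro ⟨⟨X, X'⟩, hp⟩ (rfl : X' = 0)
    have : X = 0 := eq_zero_of_forall_trace_mul fun Y => by
      obtain ⟨q, hq, rfl⟩ := hb Y
      simpa using key _ hp q hq
    subst this
    rfl
  · obtain ⟨p, hp, rfl⟩ := ha' X
    exact ⟨⟨p, hp⟩, rfl⟩

/-- If words of all lengths `a ≥ N` in the `M i` and in the `M' i` correspond by linear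
isomorphisms, then `M'` is obtained from `M` by a similarity, a scalar, and a sign on the odd
generators.

The isomorphism `φ a ε` multiplies as `φ a ε X * φ b δ Y = φ (a + b) (ε + δ) (X * Y)`. Hence each
`φ a ε 1` commutes with everything and is a scalar, so that `φ N 0` is a multiple of an algebra
automorphism, which is inner, and all other `φ a ε` are multiples of the same automorphism. -/
theorem exists_similarity_of_pairSpan_eq_graph [Nonempty m] {N : ℕ}
    (h : ∀ a, N ≤ a → ∀ ε, ∃ e : Matrix m m ℂ ≃ₗ[ℂ] Matrix m m ℂ,
      pairSpan par M M' a ε = e.toLinearMap.graph) :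
    ∃ (G : (Matrix m m ℂ)ˣ) (r s : ℂ), (s = 1 ∨ s = -1) ∧
      ∀ i, M' i = (r * s ^ (par i).val) • (G * M i * (G⁻¹ : (Matrix m m ℂ)ˣ)) := by
  choose φ hφ using h
  have hmem : ∀ {a : ℕ} (ha : N ≤ a) (ε : ZMod 2) {X X' : Matrix m m ℂ},
      (X, X') ∈ pairSpan par M M' a ε ↔ φ a ha ε X = X' := by
    intro a ha ε X X'
    rw [hφ a ha ε, LinearMap.mem_graph_iff]
    exact eq_comm
  have hmul : ∀ {a b : ℕ} (ha : N ≤ a) (hb : N ≤ b) (ε δ : ZMod 2) (X Y : Matrix m m ℂ),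
      φ a ha ε X * φ b hb δ Y = φ (a + b) (ha.trans (Nat.le_add_right a b)) (ε + δ) (X * Y) :=
    fun ha hb ε δ X Y => ((hmem _ _).1 (mul_mem_pairSpan
      ((hmem ha ε).2 (rfl : φ _ ha ε X = _)) ((hmem hb δ).2 (rfl : φ _ hb δ Y = _)))).symm
  have hscal : ∀ {a : ℕ} (ha : N ≤ a) (ε : ZMod 2), ∃ c : ℂ, φ a ha ε 1 = c • 1 := by
    intro a ha ε
    refine exists_smul_one_of_forall_commute fun Y => ?_
    obtain ⟨X, rfl⟩ := (φ a ha 0).surjective Y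
    rw [Commute, SemiconjBy, hmul, hmul, one_mul, mul_one, add_comm ε]
  choose c hc using @hscal
  obtain ⟨p, hp⟩ : ∃ p, p = c le_rfl 0 := ⟨_, rfl⟩
  have hp0 : p ≠ 0 := by
    rintro rfl
    have h1 := hc le_rfl 0
    rw [← hp, zero_smul, LinearEquiv.map_eq_zero_iff] at h1
    exact one_ne_zero h1
  -- the isomorphism at length `N` is `p` times an algebra automorphism
  have hNmul : ∀ X Y, φ N le_rfl 0 X * φ N le_rfl 0 Y = p • φ N le_rfl 0 (X * Y) := by
    intro X Y
    have h1 := hmul le_rfl le_rfl 0 0 1 (X * Y)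
    rw [one_mul, ← hmul le_rfl le_rfl 0 0 X Y, hc, ← hp, smul_one_mul] at h1
    exact h1.symm
  let f : Matrix m m ℂ ≃ₐ[ℂ] Matrix m m ℂ :=
    AlgEquiv.ofLinearEquiv ((φ N le_rfl 0).trans (LinearEquiv.smulOfNeZero ℂ _ p⁻¹ (inv_ne_zero hp0)))
      (by simp [hc, ← hp, hp0])
      (fun X Y => by
        simp only [LinearEquiv.trans_apply, LinearEquiv.smulOfNeZero_apply, smul_mul_smul, hNmul,
          smul_smul]
        congr 1
        field_simp)
  have hf : ∀ X, φ N le_rfl 0 X = p • f X := fun X => by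
    simp [f, hp0]
  obtain ⟨G, hG⟩ := exists_units_conj f
  -- all the other isomorphisms are multiples of the same automorphism
  have hall : ∀ {a : ℕ} (ha : N ≤ a) (ε : ZMod 2) (X : Matrix m m ℂ), φ a ha ε X = c ha ε • f X := by
    intro a ha ε X
    have h1 := hmul le_rfl ha 0 ε 1 X
    rw [← mul_one (1 * X), one_mul, ← hmul le_rfl ha 0 ε X 1, hc, hc, ← hp, smul_one_mul,
      mul_smul_one, hf, smul_comm] at h1
    exact smul_right_injective _ hp0 h1
  have hcmul : ∀ {a b : ℕ} (ha : N ≤ a) (hb : N ≤ b) (ε δ : ZMod 2),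
      c ha ε * c hb δ = c (ha.trans (Nat.le_add_right a b)) (ε + δ) := by
    intro a b ha hb ε δ
    have h1 := hmul ha hb ε δ 1 1
    rw [hc, hc, mul_one, hc, smul_mul_smul, mul_one] at h1
    exact smul_left_injective ℂ (one_ne_zero (α := Matrix m m ℂ)) h1
  -- the sign compares the scalars of odd and even words; it does not depend on the length
  have hsq : (c (le_refl N) 1 / p) ^ 2 = 1 := by
    have h1 := (hcmul le_rfl le_rfl 1 1).trans
      ((congrArg _ (by decide : (1 + 1 : ZMod 2) = 0 + 0)).trans (hcmul (le_refl N) le_rfl 0 0).symm)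
    rw [← hp] at h1
    rw [div_pow, sq, sq, h1, div_self (mul_ne_zero hp0 hp0)]
  have hN : N ≤ N + 1 := Nat.le_succ N
  refine ⟨G, c hN 0 / p, c le_rfl 1 / p, by simpa using hsq, fun i => ?_⟩
  have h1 : φ (N + 1) hN (0 + par i) (1 * M i) = φ N le_rfl 0 1 * M' i :=
    (hmem hN _).1 (mul_mem_pairSpan ((hmem le_rfl 0).2 rfl) (mem_pairSpan_one par M M' i))
  rw [one_mul, zero_add, hall, hc, ← hp, smul_one_mul, hG] at h1
  have h2 : c hN (par i) = c hN 0 * (c le_rfl 1 / p) ^ (par i).val := by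
    obtain hi | hi := (by decide : ∀ ε : ZMod 2, ε = 0 ∨ ε = 1) (par i) <;> rw [hi]
    · simp
    · have h3 := hcmul le_rfl hN 0 1
      have h4 := hcmul le_rfl hN 1 0
      simp only [zero_add, add_zero, ← hp] at h3 h4
      rw [ZMod.val_one, pow_one]
      field_simp
      rw [mul_comm, h3, ← h4, mul_comm]
  rw [← inv_smul_smul₀ hp0 (M' i), ← h1, h2, smul_smul]
  congr 1
  ring

end Pairs

/-! ### Fixed points of the transfer map -/

section FixedPoints

variable {ι : Type*} {m : Type*} [Fintype m] [DecidableEq m]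

open scoped ComplexOrder

/-- The kernel of a positive semidefinite fixed point is invariant under all `(M i)ᴴ`, hence under
the algebra they generate, which is the full matrix algebra. -/
theorem eq_zero_of_posSemidef_of_fixed [Fintype ι] {par : ι → ZMod 2} {M : ι → Matrix m m ℂ} {l : ℕ}
    {ε : ZMod 2} (hspan : paritySpan par M l ε = ⊤) {R : Matrix m m ℂ} (hR : R.PosSemidef)
    (hfix : ∑ i, M i * R * (M i)ᴴ = R) {x : m → ℂ} (hx : x ≠ 0) (hRx : R *ᵥ x = 0) : R = 0 := by
  have step : ∀ y : m → ℂ, R *ᵥ y = 0 → ∀ i, R *ᵥ ((M i)ᴴ *ᵥ y) = 0 := by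
    intro y hy i
    rw [← hR.dotProduct_mulVec_zero_iff]
    have hsum : ∑ i, star ((M i)ᴴ *ᵥ y) ⬝ᵥ (R *ᵥ ((M i)ᴴ *ᵥ y)) = 0 := by
      calc _ = ∑ i, star y ⬝ᵥ ((M i * R * (M i)ᴴ) *ᵥ y) := by
            refine Finset.sum_congr rfl fun i _ => ?_
            rw [Matrix.star_mulVec, Matrix.conjTranspose_conjTranspose, ← Matrix.dotProduct_mulVec,
              Matrix.mulVec_mulVec, Matrix.mulVec_mulVec, Matrix.mul_assoc]
        _ = star y ⬝ᵥ (R *ᵥ y) := by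
            rw [← dotProduct_sum, ← Matrix.sum_mulVec, hfix]
        _ = 0 := by rw [hy, dotProduct_zero]
    exact (Finset.sum_eq_zero_iff_of_nonneg fun i _ => hR.dotProduct_mulVec_nonneg _).1 hsum i
      (Finset.mem_univ i)
  have hword : ∀ L : List ι, ∀ y : m → ℂ, R *ᵥ y = 0 → R *ᵥ ((L.map M).prodᴴ *ᵥ y) = 0 := by
    intro L
    induction L with
    | nil => intro y hy; simpa using hy
    | cons i L ih =>
      intro y hy
      rw [List.map_cons, List.prod_cons, Matrix.conjTranspose_mul, ← Matrix.mulVec_mulVec]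
      exact ih _ (step y hy i)
  have hall : ∀ X ∈ paritySpan par M l ε, R *ᵥ (Xᴴ *ᵥ x) = 0 := by
    intro X hX
    refine Submodule.span_induction ?_ (by simp) (fun X Y _ _ h₁ h₂ => ?_) (fun c X _ h => ?_) hX
    · rintro _ ⟨w, -, rfl⟩
      have := hword (List.ofFn w) x hRx
      rwa [List.map_ofFn] at this
    · rw [Matrix.conjTranspose_add, Matrix.add_mulVec, Matrix.mulVec_add, h₁, h₂, add_zero]
    · rw [Matrix.conjTranspose_smul, Matrix.smul_mulVec, Matrix.mulVec_smul, h, smul_zero]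
  obtain ⟨j, hj⟩ := Function.ne_iff.1 hx
  -- every vector is the image of `x` under some matrix
  refine Matrix.ext_of_mulVec_single fun k => ?_
  have h1 := hall (Matrix.single k j (x j)⁻¹)ᴴ (hspan ▸ Submodule.mem_top)
  rw [Matrix.conjTranspose_conjTranspose, Matrix.single_mulVec] at h1
  rw [Matrix.zero_mulVec, ← h1]
  congr 1
  ext i
  simp only [Function.update_apply, Pi.single_apply, Pi.zero_apply]
  rw [inv_mul_cancel₀ hj]

/-- A Hermitian fixed point `Q` of the unital map `X ↦ ∑ M i X (M i)ᴴ` is a scalar: with `q` the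
largest eigenvalue of `Q`, the matrix `q - Q` is a singular positive semidefinite fixed point. -/
theorem exists_smul_one_of_isHermitian_of_fixed [Fintype ι] [Nonempty m] {par : ι → ZMod 2}
    {M : ι → Matrix m m ℂ} {l : ℕ} {ε : ZMod 2} (hspan : paritySpan par M l ε = ⊤)
    (hcan : IsCanonical M) {Q : Matrix m m ℂ} (hQ : Q.IsHermitian)
    (hfix : ∑ i, M i * Q * (M i)ᴴ = Q) : ∃ q : ℝ, Q = (q : ℂ) • 1 := by
  obtain ⟨j, hj⟩ := Finite.exists_max hQ.eigenvalues
  refine ⟨hQ.eigenvalues j, (sub_eq_zero.1 ?_).symm⟩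
  refine eq_zero_of_posSemidef_of_fixed hspan (x := ⇑(hQ.eigenvectorBasis j)) ?_ ?_ ?_ ?_
  · have h1 : ((hQ.eigenvalues j : ℂ) • 1 - Q) =
        (hQ.eigenvectorUnitary : Matrix m m ℂ) *
          Matrix.diagonal (fun i => ((hQ.eigenvalues j - hQ.eigenvalues i : ℝ) : ℂ)) *
          (hQ.eigenvectorUnitary : Matrix m m ℂ)ᴴ := by
      have h2 : Matrix.diagonal (fun i => ((hQ.eigenvalues j - hQ.eigenvalues i : ℝ) : ℂ)) =
          (hQ.eigenvalues j : ℂ) • (1 : Matrix m m ℂ) -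
            Matrix.diagonal (RCLike.ofReal ∘ hQ.eigenvalues) := by
        rw [Matrix.smul_one_eq_diagonal, Matrix.diagonal_sub]
        congr 1
        ext i
        simp
      have h3 := hQ.spectral_theorem
      rw [Unitary.conjStarAlgAut_apply, Matrix.star_eq_conjTranspose] at h3
      have h4 : (hQ.eigenvectorUnitary : Matrix m m ℂ) *
          (hQ.eigenvectorUnitary : Matrix m m ℂ)ᴴ = 1 :=
        Unitary.coe_mul_star_self hQ.eigenvectorUnitary
      rw [h2, mul_sub, sub_mul, ← h3, mul_smul_one, smul_mul_assoc, h4]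
    rw [h1]
    refine Matrix.PosSemidef.mul_mul_conjTranspose_same (Matrix.PosSemidef.diagonal fun i => ?_) _
    simpa using hj i
  · simp_rw [mul_sub, sub_mul, Finset.sum_sub_distrib, hfix, mul_smul_one, smul_mul_assoc]
    rw [← Finset.smul_sum, hcan]
  · exact fun h => hQ.eigenvectorBasis.orthonormal.ne_zero j (by ext i; exact congrFun h i)
  · rw [Matrix.sub_mulVec, hQ.mulVec_eigenvectorBasis, Matrix.smul_mulVec, Matrix.one_mulVec]
    ext i
    simp

/-- A similarity that preserves the canonical form, up to a phase, is a unitary up to a scalar: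
`(Gᴴ G)⁻¹` is a fixed point of the transfer map. -/
theorem exists_unitary_of_similarity [Fintype ι] [Nonempty m] {par : ι → ZMod 2}
    {M M' : ι → Matrix m m ℂ} {l : ℕ} {ε : ZMod 2} (hspan : paritySpan par M l ε = ⊤)
    (hcan : IsCanonical M) (hcan' : IsCanonical M') (G : (Matrix m m ℂ)ˣ) {d : ι → ℂ}
    (hd : ∀ i, ‖d i‖ = 1) (h : ∀ i, M' i = d i • (G * M i * (G⁻¹ : (Matrix m m ℂ)ˣ))) :
    ∃ U : Matrix.unitaryGroup m ℂ, ∀ i,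
      M' i = d i • ((U : Matrix m m ℂ) * M i * (U : Matrix m m ℂ)ᴴ) := by
  obtain ⟨H, hH⟩ : ∃ H : Matrix m m ℂ, H = (G⁻¹ : (Matrix m m ℂ)ˣ) := ⟨_, rfl⟩
  have hGH : (G : Matrix m m ℂ) * H = 1 := by rw [hH, Units.mul_inv]
  have hHG : H * (G : Matrix m m ℂ) = 1 := by rw [hH, Units.inv_mul]
  simp only [← hH] at h
  have hdd : ∀ i, d i * star (d i) = 1 := fun i => by
    rw [RCLike.star_def, RCLike.mul_conj, hd]; simp
  have hfix : ∑ i, M i * (H * Hᴴ) * (M i)ᴴ = H * Hᴴ := by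
    have h1 : ∀ i, M i * (H * Hᴴ) * (M i)ᴴ = H * (M' i * (M' i)ᴴ) * Hᴴ := by
      intro i
      rw [h i, Matrix.conjTranspose_smul, smul_mul_smul, hdd, one_smul]
      simp only [Matrix.conjTranspose_mul, ← mul_assoc]
      rw [hHG, one_mul]
      rw [mul_assoc _ (G : Matrix m m ℂ)ᴴ, ← Matrix.conjTranspose_mul, hHG]
      simp
    simp_rw [h1]
    rw [← Finset.sum_mul, ← Finset.mul_sum, hcan', mul_one]
  obtain ⟨q, hq⟩ := exists_smul_one_of_isHermitian_of_fixed hspan hcan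
    (Matrix.isHermitian_mul_conjTranspose_self H) hfix
  have hpos : 0 < q := by
    have h1 : (H * Hᴴ).PosDef := Matrix.PosDef.mul_conjTranspose_self H fun v w hvw => by
      have := congrArg (fun v => v ᵥ* (G : Matrix m m ℂ)) hvw
      simpa [Matrix.vecMul_vecMul, hHG] using this
    have h2 := h1.diag_pos (i := Classical.arbitrary m)
    rw [hq] at h2
    simpa using h2
  obtain ⟨t, ht⟩ : ∃ t : ℝ, t * t = q := ⟨√q, Real.mul_self_sqrt hpos.le⟩
  have ht0 : (t : ℂ) ≠ 0 := by
    rintro h0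
    rw [Complex.ofReal_eq_zero] at h0
    simp [h0] at ht
    exact hpos.ne ht
  have hGH' : (G : Matrix m m ℂ) = (q : ℂ)⁻¹ • Hᴴ := by
    have h0 : (q : ℂ) ≠ 0 := by exact_mod_cast hpos.ne'
    have h1 : (G : Matrix m m ℂ) * (H * Hᴴ) = Hᴴ := by rw [← mul_assoc, hGH, one_mul]
    rw [hq, mul_smul_one] at h1
    rw [← h1, inv_smul_smul₀ h0]
  have hU : (t : ℂ) • (G : Matrix m m ℂ) = ((t : ℂ)⁻¹ • H)ᴴ := by
    rw [hGH', Matrix.conjTranspose_smul, smul_smul, ← ht]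
    congr 1
    rw [RCLike.star_def, map_inv₀, Complex.conj_ofReal]
    push_cast
    field_simp
  have hUs : ((t : ℂ) • (G : Matrix m m ℂ))ᴴ = (t : ℂ)⁻¹ • H := by
    rw [hU, Matrix.conjTranspose_conjTranspose]
  refine ⟨⟨(t : ℂ) • (G : Matrix m m ℂ), Matrix.mem_unitaryGroup_iff.2 ?_⟩, fun i => ?_⟩
  · rw [Matrix.star_eq_conjTranspose, hUs, smul_mul_smul, hGH, mul_inv_cancel₀ ht0, one_smul]
  · change M' i = d i • ((t : ℂ) • (G : Matrix m m ℂ) * M i * ((t : ℂ) • (G : Matrix m m ℂ))ᴴ)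
    rw [hUs, h i, smul_mul_assoc, smul_mul_smul, mul_inv_cancel₀ ht0, one_smul]

/-- The fundamental theorem for even or odd words only: if in each length the words of one parity
`κ` have the same traces up to a phase, then the two families agree up to a unitary
conjugation, a phase, and a sign on the odd generators. -/
theorem exists_unitary_of_trace_wordProd [Fintype ι] [Nonempty m] {par : ι → ZMod 2}
    {M M' : ι → Matrix m m ℂ} {l l' : ℕ} (hspan : ∀ ε, paritySpan par M l ε = ⊤)
    (hspan' : ∀ ε, paritySpan par M' l' ε = ⊤) (hcan : IsCanonical M) (hcan' : IsCanonical M')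
    (κ : ZMod 2)
    (h : ∀ L : ℕ, 1 ≤ L → ∃ α : Circle, ∀ w : Fin L → ι, ∑ k, par (w k) = κ →
      (wordProd M w).trace = α * (wordProd M' w).trace) :
    ∃ (U : Matrix.unitaryGroup m ℂ) (r : Circle) (s : ℂ), (s = 1 ∨ s = -1) ∧
      ∀ i, M' i = ((r : ℂ) * s ^ (par i).val) •
        ((U : Matrix m m ℂ) * M i * (U : Matrix m m ℂ)ᴴ) := by
  obtain ⟨N, hN, hl, hl'⟩ : ∃ N, 1 ≤ N ∧ l ≤ N ∧ l' ≤ N := ⟨l + l' + 1, by omega, by omega, by omega⟩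
  obtain ⟨G, r, s, hs, hG⟩ := exists_similarity_of_pairSpan_eq_graph (par := par) (M := M)
    (M' := M') (N := N) fun a ha ε => by
      obtain ⟨α, hα⟩ := h (a + a) (by omega)
      refine exists_equiv_pairSpan_eq_graph (δ := κ - ε) α.coe_ne_zero
        (paritySpan_eq_top_of_le hspan (hl.trans ha) _)
        (paritySpan_eq_top_of_le hspan' (hl'.trans ha) _)
        (paritySpan_eq_top_of_le hspan (hl.trans ha) _)
        (paritySpan_eq_top_of_le hspan' (hl'.trans ha) _) fun w hw => hα w ?_
      rw [hw, add_sub_cancel]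
  have hs1 : ‖s‖ = 1 := by rcases hs with rfl | rfl <;> simp
  -- some word of parity `κ` has nonzero trace, and comparing its two traces gives `‖r‖ = 1`
  have hr : ‖r‖ = 1 := by
    obtain ⟨w, hw, hw0⟩ : ∃ w : Fin N → ι, ∑ k, par (w k) = κ ∧ (wordProd M w).trace ≠ 0 := by
      by_contra! hcon
      have h1 : paritySpan par M N κ ≤ LinearMap.ker (Matrix.traceLinearMap m ℂ ℂ) := by
        rw [paritySpan, Submodule.span_le]
        rintro _ ⟨w, hw, rfl⟩
        exact hcon w hw
      rw [paritySpan_eq_top_of_le hspan hl] at h1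
      have h2 : (1 : Matrix m m ℂ).trace = 0 := h1 Submodule.mem_top
      simp at h2
    obtain ⟨α, hα⟩ := h N hN
    have hword : ∀ L : List ι, ∃ t : ℂ, ‖t‖ = ‖r‖ ^ L.length ∧
        (L.map M').prod = t • (G * (L.map M).prod * (G⁻¹ : (Matrix m m ℂ)ˣ)) := by
      intro L
      induction L with
      | nil => exact ⟨1, by simp, by simp⟩
      | cons i L ih =>
        obtain ⟨t, ht, hL⟩ := ih
        refine ⟨r * s ^ (par i).val * t, ?_, ?_⟩
        · rw [norm_mul, norm_mul, norm_pow, hs1, one_pow, mul_one, ht, List.length_cons, pow_succ']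
        · rw [List.map_cons, List.prod_cons, hL, hG, smul_mul_smul, List.map_cons, List.prod_cons]
          congr 1
          simp only [mul_assoc, Units.inv_mul_cancel_left]
    obtain ⟨t, ht, hw'⟩ := hword (List.ofFn w)
    rw [List.map_ofFn, List.map_ofFn] at hw'
    have h1 : (wordProd M' w).trace = t * (wordProd M w).trace := by
      have h2 := congrArg Matrix.trace hw'
      rw [Matrix.trace_smul, Matrix.trace_mul_cycle, Units.inv_mul, one_mul] at h2
      exact h2
    have h2 := congrArg norm (hα w hw)
    rw [h1, norm_mul, norm_mul, Circle.norm_coe, one_mul, ht, List.length_ofFn] at h2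
    have h3 : ‖r‖ ^ N = 1 := by
      have := norm_ne_zero_iff.2 hw0
      exact mul_right_cancel₀ this (by rw [one_mul]; exact h2.symm)
    exact (pow_eq_one_iff_of_nonneg (norm_nonneg _) (by omega)).1 h3
  obtain ⟨U, hU⟩ := exists_unitary_of_similarity (hspan 0) hcan hcan' G
    (d := fun i => r * s ^ (par i).val) (fun i => by simp [hr, hs1]) hG
  exact ⟨U, ⟨r, mem_sphere_zero_iff_norm.2 hr⟩, s, hs, hU⟩

end FixedPoints

/-! ### The algebra generated by an injective family and its Wall matrices -/

theorem pauliX_mul_self : pauliX * pauliX = 1 := by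
  ext i j
  fin_cases i <;> fin_cases j <;> simp [pauliX, Matrix.mul_apply]

theorem pauliX_conjTranspose : pauliXᴴ = pauliX := by
  ext i j
  fin_cases i <;> fin_cases j <;> simp [pauliX]

theorem pauliZ_mul_self : pauliZ * pauliZ = 1 := by
  ext i j
  fin_cases i <;> fin_cases j <;> simp [pauliZ, Matrix.mul_apply]

theorem pauliZ_conjTranspose : pauliZᴴ = pauliZ := by
  ext i j
  fin_cases i <;> fin_cases j <;> simp [pauliZ]

theorem pauliZ_mul_pauliX_mul_pauliZ : pauliZ * pauliX * pauliZ = -pauliX := by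
  ext i j
  fin_cases i <;> fin_cases j <;> simp [pauliZ, pauliX, Matrix.mul_apply]

theorem zmod_two_eq_zero_or_one (ε : ZMod 2) : ε = 0 ∨ ε = 1 := by
  revert ε
  decide

theorem pauliX_pow_val_mul (ε δ : ZMod 2) :
    pauliX ^ ε.val * pauliX ^ δ.val = pauliX ^ (ε + δ).val := by
  obtain rfl | rfl := zmod_two_eq_zero_or_one ε <;> obtain rfl | rfl := zmod_two_eq_zero_or_one δ <;>
    simp [ZMod.val_one, pauliX_mul_self, (by decide : (1 + 1 : ZMod 2) = 0)]

theorem trace_pauliX_pow_val (ε : ZMod 2) :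
    (pauliX ^ ε.val).trace = if ε = 0 then 2 else 0 := by
  obtain rfl | rfl := zmod_two_eq_zero_or_one ε
  · simp
  · simp [ZMod.val_one, pauliX, Matrix.trace]

section Unitary

variable {k : Type*} [Fintype k] [DecidableEq k]

theorem unitary_conjTranspose_mul (W : Matrix.unitaryGroup k ℂ) :
    (W : Matrix k k ℂ)ᴴ * (W : Matrix k k ℂ) = 1 :=
  Unitary.coe_star_mul_self W

theorem unitary_mul_conjTranspose (W : Matrix.unitaryGroup k ℂ) :
    (W : Matrix k k ℂ) * (W : Matrix k k ℂ)ᴴ = 1 :=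
  Unitary.coe_mul_star_self W

theorem unitary_coe_inv (W : Matrix.unitaryGroup k ℂ) :
    ((W⁻¹ : Matrix.unitaryGroup k ℂ) : Matrix k k ℂ) = (W : Matrix k k ℂ)ᴴ :=
  rfl

theorem unitary_conj_mul_conj (W : Matrix.unitaryGroup k ℂ) (X Y : Matrix k k ℂ) :
    (W : Matrix k k ℂ) * X * (W : Matrix k k ℂ)ᴴ * ((W : Matrix k k ℂ) * Y * (W : Matrix k k ℂ)ᴴ) =
      (W : Matrix k k ℂ) * (X * Y) * (W : Matrix k k ℂ)ᴴ := by
  simp only [mul_assoc]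
  rw [← mul_assoc (W : Matrix k k ℂ)ᴴ, unitary_conjTranspose_mul, one_mul]

theorem trace_unitary_conj (W : Matrix.unitaryGroup k ℂ) (X : Matrix k k ℂ) :
    ((W : Matrix k k ℂ) * X * (W : Matrix k k ℂ)ᴴ).trace = X.trace := by
  rw [Matrix.trace_mul_cycle, unitary_conjTranspose_mul, one_mul]

theorem unitary_conj_injective (W : Matrix.unitaryGroup k ℂ) :
    Function.Injective fun X : Matrix k k ℂ => (W : Matrix k k ℂ) * X * (W : Matrix k k ℂ)ᴴ := by
  refine Function.LeftInverse.injective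
    (g := fun X => (W : Matrix k k ℂ)ᴴ * X * (W : Matrix k k ℂ)) fun X => ?_
  simp only [← mul_assoc, unitary_conjTranspose_mul, one_mul]
  rw [mul_assoc, unitary_conjTranspose_mul, mul_one]

theorem eq_unitary_conj (W : Matrix.unitaryGroup k ℂ) (X : Matrix k k ℂ) :
    X = (W : Matrix k k ℂ) * ((W : Matrix k k ℂ)ᴴ * X * (W : Matrix k k ℂ)) *
      (W : Matrix k k ℂ)ᴴ := by
  simp only [← mul_assoc, unitary_mul_conjTranspose, one_mul]
  rw [mul_assoc, unitary_mul_conjTranspose, mul_one]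

/-- The exponential of a multiple of an involution, obtained from that of `ℂ × ℂ` by evaluating on
the two eigenvalues `1` and `-1`. -/
theorem exp_smul_of_mul_self_eq_one {u : Matrix k k ℂ} (hu : u * u = 1) (s : ℂ) :
    NormedSpace.exp (s • u) = Complex.cosh s • 1 + Complex.sinh s • u := by
  let f : ℂ × ℂ →+* Matrix k k ℂ :=
    { toFun := fun x => ((x.1 + x.2) / 2) • 1 + ((x.1 - x.2) / 2) • u
      map_one' := by simp
      map_zero' := by simp
      map_add' := fun x y => by simp only [Prod.fst_add, Prod.snd_add]; module
      map_mul' := fun x y => by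
        simp only [Prod.fst_mul, Prod.snd_mul, mul_add, add_mul, smul_mul_smul, mul_one, one_mul,
          hu]
        module }
  have hf : Continuous f := by
    change Continuous fun x : ℂ × ℂ =>
      ((x.1 + x.2) / 2) • (1 : Matrix k k ℂ) + ((x.1 - x.2) / 2) • u
    fun_prop
  have h : f (NormedSpace.exp (s, -s)) = NormedSpace.exp (f (s, -s)) := by
    let _ : NormedRing (Matrix k k ℂ) := Matrix.linftyOpNormedRing
    exact NormedSpace.map_exp f hf (s, -s)
  have h1 : f (s, -s) = s • u := by
    change ((s + -s) / 2) • (1 : Matrix k k ℂ) + ((s - -s) / 2) • u = _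
    module
  rw [h1] at h
  rw [← h]
  change (((NormedSpace.exp (s, -s)).1 + (NormedSpace.exp (s, -s)).2) / 2) • (1 : Matrix k k ℂ) +
    (((NormedSpace.exp (s, -s)).1 - (NormedSpace.exp (s, -s)).2) / 2) • u = _
  rw [Prod.fst_exp, Prod.snd_exp, ← Complex.exp_eq_exp_ℂ]
  rfl

end Unitary

section Wall

variable {ι : Type*} {par : ι → ZMod 2} {n : ℕ} {A : ι → BondMatrix n} {u : BondMatrix n}

theorem wordProd_kronecker {W : BondUnitary n} {B : ι → Matrix (Fin n) (Fin n) ℂ}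
    (hA : ∀ i, A i = (W : BondMatrix n) * ((pauliX ^ (par i).val) ⊗ₖ B i) * (W : BondMatrix n)ᴴ)
    {L : ℕ} (w : Fin L → ι) :
    wordProd A w = (W : BondMatrix n) * ((pauliX ^ (∑ k, par (w k)).val) ⊗ₖ wordProd B w) *
      (W : BondMatrix n)ᴴ := by
  induction L with
  | zero =>
    simp [wordProd_zero, unitary_mul_conjTranspose]
  | succ L ih =>
    rw [wordProd_succ, ih, hA, unitary_conj_mul_conj, ← Matrix.mul_kronecker_mul,
      pauliX_pow_val_mul, ← wordProd_succ, Fin.sum_univ_succ]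

theorem kronecker_mem_paritySpan {W : BondUnitary n} {B : ι → Matrix (Fin n) (Fin n) ℂ}
    (hA : ∀ i, A i = (W : BondMatrix n) * ((pauliX ^ (par i).val) ⊗ₖ B i) * (W : BondMatrix n)ᴴ)
    {l : ℕ} {ε : ZMod 2} {X : Matrix (Fin n) (Fin n) ℂ} (hX : X ∈ paritySpan par B l ε) :
    (W : BondMatrix n) * ((pauliX ^ ε.val) ⊗ₖ X) * (W : BondMatrix n)ᴴ ∈ paritySpan par A l ε := by
  refine Submodule.span_induction ?_ ?_ (fun X Y _ _ h₁ h₂ => ?_) (fun c X _ h => ?_) hX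
  · rintro _ ⟨w, rfl, rfl⟩
    rw [← wordProd_kronecker hA]
    exact wordProd_mem_paritySpan par A w
  · rw [Matrix.kronecker_zero, mul_zero, zero_mul]
    exact Submodule.zero_mem _
  · rw [Matrix.kronecker_add, mul_add, add_mul]
    exact Submodule.add_mem _ h₁ h₂
  · rw [Matrix.kronecker_smul, mul_smul_comm, smul_mul_assoc]
    exact Submodule.smul_mem _ _ h

theorem IsWallMatrix.mul_self (hu : IsWallMatrix par A u) : u * u = 1 := by
  obtain ⟨W, rfl, -⟩ := hu
  rw [unitary_conj_mul_conj, ← Matrix.mul_kronecker_mul, pauliX_mul_self, mul_one,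
    Matrix.one_kronecker_one, mul_one, unitary_mul_conjTranspose]

theorem IsWallMatrix.conjTranspose (hu : IsWallMatrix par A u) : uᴴ = u := by
  obtain ⟨W, rfl, -⟩ := hu
  rw [Matrix.conjTranspose_mul, Matrix.conjTranspose_mul, Matrix.conjTranspose_conjTranspose,
    Matrix.conjTranspose_kronecker, pauliX_conjTranspose, Matrix.conjTranspose_one, mul_assoc]

theorem IsWallMatrix.trace_eq_zero (hu : IsWallMatrix par A u) : u.trace = 0 := by
  obtain ⟨W, rfl, -⟩ := hu
  rw [trace_unitary_conj, Matrix.trace_kronecker]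
  simp [pauliX, Matrix.trace]

theorem IsWallMatrix.commute (hu : IsWallMatrix par A u) (i : ι) : Commute u (A i) := by
  obtain ⟨W, rfl, B, hA, -⟩ := hu
  rw [hA, Commute, SemiconjBy, unitary_conj_mul_conj, unitary_conj_mul_conj,
    ← Matrix.mul_kronecker_mul, ← Matrix.mul_kronecker_mul, one_mul, mul_one, ← pow_succ,
    ← pow_succ']

/-- The identity is an even element in all large lengths. -/
theorem IsWallMatrix.exists_one_mem_paritySpan (hn : 1 ≤ n) (hu : IsWallMatrix par A u) :
    ∃ l, ∀ a, l ≤ a → (1 : BondMatrix n) ∈ paritySpan par A a 0 := by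
  have : NeZero n := ⟨by omega⟩
  obtain ⟨W, rfl, B, hA, l, h0, h1⟩ := hu
  refine ⟨l, fun a ha => ?_⟩
  have hspan : ∀ ε, paritySpan par B l ε = ⊤ := fun ε => by
    obtain rfl | rfl := zmod_two_eq_zero_or_one ε <;> assumption
  have h2 := kronecker_mem_paritySpan hA
    (show (1 : Matrix (Fin n) (Fin n) ℂ) ∈ paritySpan par B a 0 from
      paritySpan_eq_top_of_le hspan ha 0 ▸ Submodule.mem_top)
  simpa [unitary_mul_conjTranspose] using h2

theorem IsWallMatrix.mem_adjoin (hu : IsWallMatrix par A u) :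
    u ∈ Algebra.adjoin ℂ (Set.range A) := by
  obtain ⟨W, rfl, B, hA, l, -, h1⟩ := hu
  have h2 := kronecker_mem_paritySpan hA
    (show (1 : Matrix (Fin n) (Fin n) ℂ) ∈ paritySpan par B l 1 from h1 ▸ Submodule.mem_top)
  rw [ZMod.val_one, pow_one] at h2
  exact mem_adjoin_of_mem_paritySpan h2

/-- The commutant of `1 ⊗ M_n` in `M_2 ⊗ M_n` is `M_2 ⊗ 1`. -/
theorem exists_kronecker_one_of_forall_commute {Y : BondMatrix n}
    (h : ∀ X : Matrix (Fin n) (Fin n) ℂ,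
      Commute Y ((1 : Matrix (Fin 2) (Fin 2) ℂ) ⊗ₖ X)) :
    ∃ y : Matrix (Fin 2) (Fin 2) ℂ, Y = y ⊗ₖ (1 : Matrix (Fin n) (Fin n) ℂ) := by
  have h1 : ∀ p q, ∃ c : ℂ, (Matrix.of fun i j => Y (p, i) (q, j)) =
      c • (1 : Matrix (Fin n) (Fin n) ℂ) := by
    intro p q
    refine exists_smul_one_of_forall_commute fun X => ?_
    ext i j
    have h2 := congrFun (congrFun (h X).eq (p, i)) (q, j)
    simpa [Matrix.mul_apply, Fintype.sum_prod_type, Matrix.kronecker_apply, Matrix.one_apply]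
      using h2
  choose y hy using h1
  refine ⟨Matrix.of y, ?_⟩
  ext ⟨p, i⟩ ⟨q, j⟩
  exact congrFun (congrFun (hy p q) i) j

/-- The commutant of an injective family with Wall invariant `(-)` is spanned by `1` and `u`: even
words span a copy of `1 ⊗ M_n`, with commutant `M_2 ⊗ 1`, and `u` is an odd element. -/
theorem IsWallMatrix.exists_eq_of_forall_commute (hn : 1 ≤ n) (hu : IsWallMatrix par A u)
    {X : BondMatrix n} (hX : ∀ i, Commute X (A i)) : ∃ a b : ℂ, X = a • 1 + b • u := by
  have : NeZero n := ⟨by omega⟩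
  obtain ⟨W, rfl, B, hA, l, h0, h1⟩ := hu
  obtain ⟨Y, hY⟩ : ∃ Y, Y = (W : BondMatrix n)ᴴ * X * (W : BondMatrix n) := ⟨_, rfl⟩
  have hXY : X = (W : BondMatrix n) * Y * (W : BondMatrix n)ᴴ := by
    rw [hY]
    exact eq_unitary_conj W X
  have hcomm : ∀ (ε : ZMod 2), paritySpan par B l ε = ⊤ → ∀ Z : Matrix (Fin n) (Fin n) ℂ,
      Commute Y ((pauliX ^ ε.val) ⊗ₖ Z) := by
    intro ε hε Z
    have h2 : Commute X _ := commute_of_mem_paritySpan hX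
      (kronecker_mem_paritySpan hA (hε ▸ Submodule.mem_top : Z ∈ paritySpan par B l ε))
    rw [hXY, Commute, SemiconjBy, unitary_conj_mul_conj, unitary_conj_mul_conj] at h2
    exact unitary_conj_injective W h2
  obtain ⟨y, rfl⟩ := exists_kronecker_one_of_forall_commute (Y := Y) (by simpa using hcomm 0 h0)
  have h2 := (hcomm 1 h1 1).eq
  rw [ZMod.val_one, pow_one, ← Matrix.mul_kronecker_mul, ← Matrix.mul_kronecker_mul] at h2
  have hy : y = y 0 0 • 1 + y 0 1 • pauliX := by
    have e0 := congrFun (congrFun h2 (0, 0)) (1, 0)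
    have e1 := congrFun (congrFun h2 (0, 0)) (0, 0)
    simp [pauliX, Matrix.mul_apply, Matrix.vecMul, dotProduct] at e0 e1
    ext i j
    fin_cases i <;> fin_cases j <;> simp [pauliX, e0, e1]
  refine ⟨y 0 0, y 0 1, ?_⟩
  rw [hXY]
  conv_lhs => rw [hy]
  rw [Matrix.add_kronecker, Matrix.smul_kronecker, Matrix.smul_kronecker, Matrix.one_kronecker_one,
    mul_add, add_mul, mul_smul_comm, smul_mul_assoc, mul_one, unitary_mul_conjTranspose,
    mul_smul_comm, smul_mul_assoc]

theorem IsWallMatrix.commute_smul_add (hu : IsWallMatrix par A u) (a b : ℂ) (i : ι) :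
    Commute (a • 1 + b • u) (A i) :=
  ((Commute.one_left _).smul_left a).add_left ((hu.commute i).smul_left b)

theorem IsWallMatrix.smul_add_mul (hu : IsWallMatrix par A u) (a b c d : ℂ) :
    (a • 1 + b • u) * (c • 1 + d • u) = (a * c + b * d) • 1 + (a * d + b * c) • u := by
  simp only [mul_add, add_mul, smul_mul_smul, mul_one, one_mul, hu.mul_self]
  module

/-- `1` and `u` are linearly independent. -/
theorem IsWallMatrix.smul_add_eq_one_iff (hn : 1 ≤ n) (hu : IsWallMatrix par A u) {a b : ℂ} :
    a • (1 : BondMatrix n) + b • u = 1 ↔ a = 1 ∧ b = 0 := by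
  refine ⟨fun h => ?_, by rintro ⟨rfl, rfl⟩; simp⟩
  have hn0 : (n : ℂ) ≠ 0 := by exact_mod_cast (by omega : n ≠ 0)
  have h1 := congrArg Matrix.trace h
  have h2 := congrArg (fun X => (X * u).trace) h
  simp [hu.trace_eq_zero, hn0, add_mul, hu.mul_self] at h1 h2
  exact ⟨h1, h2⟩

/-- The traceless involutions in the commutant are `u` and `-u`. -/
theorem IsWallMatrix.eq_or_eq_neg (hn : 1 ≤ n) (hu : IsWallMatrix par A u) {X : BondMatrix n}
    (hX : ∀ i, Commute X (A i)) (hXX : X * X = 1) (htr : X.trace = 0) : X = u ∨ X = -u := by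
  obtain ⟨a, b, rfl⟩ := hu.exists_eq_of_forall_commute hn hX
  have hn0 : n ≠ 0 := by omega
  have ha : a = 0 := by simpa [hu.trace_eq_zero, hn0] using htr
  subst ha
  rw [hu.smul_add_mul, hu.smul_add_eq_one_iff hn, zero_mul, zero_add] at hXX
  obtain rfl | rfl := mul_self_eq_one_iff.1 hXX.1 <;> simp

theorem IsWallMatrix.mem_centralUnitaries_iff (hn : 1 ≤ n) (hu : IsWallMatrix par A u)
    {z : BondUnitary n} :
    z ∈ centralUnitaries A ↔ ∀ i, Commute (z : BondMatrix n) (A i) := by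
  refine ⟨fun hz i => hz.2 _ (Algebra.subset_adjoin ⟨i, rfl⟩), fun hz => ⟨?_, fun a ha => ?_⟩⟩
  · obtain ⟨a, b, hab⟩ := hu.exists_eq_of_forall_commute hn hz
    rw [hab]
    exact add_mem (Subalgebra.smul_mem _ (one_mem _) a) (Subalgebra.smul_mem _ hu.mem_adjoin b)
  · have h1 : Algebra.adjoin ℂ (Set.range A) ≤
        Subalgebra.centralizer ℂ {(z : BondMatrix n)} := Algebra.adjoin_le <| by
      rintro _ ⟨i, rfl⟩
      exact Subalgebra.mem_centralizer_iff ℂ |>.2 fun y hy => by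
        rw [Set.mem_singleton_iff.1 hy]; exact hz i
    exact (Subalgebra.mem_centralizer_iff ℂ).1 (h1 ha) _ rfl

theorem IsWallMatrix.phaseExp_eq (hu : IsWallMatrix par A u) (α θ : ℝ) :
    phaseExp α θ u = (Complex.exp (Complex.I * α) * Complex.cosh (Complex.I * θ)) • 1 +
      (Complex.exp (Complex.I * α) * Complex.sinh (Complex.I * θ)) • u := by
  rw [phaseExp, exp_smul_of_mul_self_eq_one hu.mul_self, smul_add, smul_smul, smul_smul]

/-- `a + b u` has the two eigenvalues `a ± b`, so it is unitary when both are phases. -/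
theorem IsWallMatrix.smul_add_mem_unitaryGroup_iff (hn : 1 ≤ n) (hu : IsWallMatrix par A u)
    {a b : ℂ} :
    a • 1 + b • u ∈ Matrix.unitaryGroup (Fin 2 × Fin n) ℂ ↔ ‖a + b‖ = 1 ∧ ‖a - b‖ = 1 := by
  have hnorm : ∀ z : ℂ, ‖z‖ = 1 ↔ z * star z = 1 := fun z => by
    rw [RCLike.star_def, Complex.mul_conj, Complex.normSq_eq_norm_sq]
    norm_cast
    exact (pow_eq_one_iff_of_nonneg (norm_nonneg z) two_ne_zero).symm
  rw [Matrix.mem_unitaryGroup_iff, Matrix.star_eq_conjTranspose, Matrix.conjTranspose_add,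
    Matrix.conjTranspose_smul, Matrix.conjTranspose_smul, Matrix.conjTranspose_one,
    hu.conjTranspose, hu.smul_add_mul, hu.smul_add_eq_one_iff hn, hnorm, hnorm, star_add, star_sub]
  constructor
  · rintro ⟨h1, h2⟩
    exact ⟨by linear_combination h1 + h2, by linear_combination h1 - h2⟩
  · rintro ⟨h1, h2⟩
    exact ⟨by linear_combination (h1 + h2) / 2, by linear_combination (h1 - h2) / 2⟩

/-- With `a + b = e^{ix}` and `a - b = e^{iy}`, the phases are `α = (x + y) / 2` and
`θ = (x - y) / 2`. -/
theorem IsWallMatrix.exists_centralUnitaries_iff (hn : 1 ≤ n) (hu : IsWallMatrix par A u)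
    (z : BondMatrix n) :
    (∃ y ∈ centralUnitaries A, (y : BondMatrix n) = z) ↔ ∃ α θ : ℝ, z = phaseExp α θ u := by
  have hexp : ∀ w : ℂ, ‖w‖ = 1 → w = Complex.exp (Complex.I * (Complex.arg w : ℝ)) := fun w hw => by
    conv_lhs => rw [← Complex.norm_mul_exp_arg_mul_I w, hw]
    rw [Complex.ofReal_one, one_mul, mul_comm]
  constructor
  · rintro ⟨y, hy, rfl⟩
    rw [hu.mem_centralUnitaries_iff hn] at hy
    obtain ⟨a, b, hab⟩ := hu.exists_eq_of_forall_commute hn hy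
    have hy' := y.2
    rw [hab, hu.smul_add_mem_unitaryGroup_iff hn] at hy'
    have e1 := hexp _ hy'.1
    have e2 := hexp _ hy'.2
    obtain ⟨s, hs⟩ : ∃ s : ℝ, s = Complex.arg (a + b) := ⟨_, rfl⟩
    obtain ⟨t, ht⟩ : ∃ t : ℝ, t = Complex.arg (a - b) := ⟨_, rfl⟩
    rw [← hs] at e1
    rw [← ht] at e2
    have e3 : Complex.exp (Complex.I * ((s + t) / 2 : ℝ)) *
        Complex.exp (Complex.I * ((s - t) / 2 : ℝ)) = a + b := by
      rw [e1, ← Complex.exp_add]; congr 1; push_cast; ring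
    have e4 : Complex.exp (Complex.I * ((s + t) / 2 : ℝ)) *
        Complex.exp (-(Complex.I * ((s - t) / 2 : ℝ))) = a - b := by
      rw [e2, ← Complex.exp_add]; congr 1; push_cast; ring
    refine ⟨(s + t) / 2, (s - t) / 2, ?_⟩
    rw [hab, hu.phaseExp_eq, Complex.cosh, Complex.sinh]
    congr 2
    · linear_combination (-e3 - e4) / 2
    · linear_combination (e4 - e3) / 2
  · rintro ⟨α, θ, rfl⟩
    have h1 : phaseExp α θ u ∈ Matrix.unitaryGroup (Fin 2 × Fin n) ℂ := by
      rw [hu.phaseExp_eq, hu.smul_add_mem_unitaryGroup_iff hn, ← mul_add, ← mul_sub,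
        Complex.cosh_add_sinh, Complex.cosh_sub_sinh]
      simp [Complex.norm_exp]
    refine ⟨⟨_, h1⟩, (hu.mem_centralUnitaries_iff hn).2 fun i => ?_, rfl⟩
    change Commute (phaseExp α θ u) (A i)
    rw [hu.phaseExp_eq]
    exact hu.commute_smul_add _ _ i

end Wall

/-! ### Gauge relations and physical states -/

section Gauge

variable {ι : Type*} {par : ι → ZMod 2} {n : ℕ} {A A' : ι → BondMatrix n}

theorem samePhysicalState_iff {Ω Ω' : BondMatrix n} :
    SamePhysicalState A Ω A' Ω' ↔ ∀ L : ℕ, 1 ≤ L → ∃ α : Circle, ∀ w : Fin L → ι,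
      (Ω * wordProd A w).trace = α * (Ω' * wordProd A' w).trace := by
  refine forall₂_congr fun L _ => exists_congr fun α => ⟨fun h w => ?_, fun h => ?_⟩
  · exact congrFun (congrArg WithLp.ofLp h) w
  · ext w
    exact h w

theorem GaugeRelated.wordProd_eq {c : Circle} {V : BondUnitary n} (h : GaugeRelated A A' c V)
    {L : ℕ} (w : Fin L → ι) :
    wordProd A' w =
      (c : ℂ) ^ L • ((V : BondMatrix n)ᴴ * wordProd A w * (V : BondMatrix n)) := by
  induction L with
  | zero => simp [wordProd_zero, unitary_conjTranspose_mul]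
  | succ L ih =>
    rw [wordProd_succ, ih, h, smul_mul_smul, ← pow_succ', wordProd_succ]
    congr 1
    simp only [mul_assoc]
    rw [← mul_assoc (V : BondMatrix n) (V : BondMatrix n)ᴴ, unitary_mul_conjTranspose, one_mul]

theorem GaugeRelated.samePhysicalState {c : Circle} {V : BondUnitary n}
    (h : GaugeRelated A A' c V) {Ω Ω' : BondMatrix n} {η : ℂ} (hη : η = 1 ∨ η = -1)
    (hΩ : Ω' = η • ((V : BondMatrix n)ᴴ * Ω * (V : BondMatrix n))) :
    SamePhysicalState A Ω A' Ω' := by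
  have hη1 : ‖η‖ = 1 := by rcases hη with rfl | rfl <;> simp
  obtain ⟨ζ, hζ⟩ : ∃ ζ : Circle, (ζ : ℂ) = η := ⟨⟨η, mem_sphere_zero_iff_norm.2 hη1⟩, rfl⟩
  refine samePhysicalState_iff.2 fun L _ => ⟨(ζ * c ^ L)⁻¹, fun w => ?_⟩
  have h1 : (Ω' * wordProd A' w).trace = (η * (c : ℂ) ^ L) * (Ω * wordProd A w).trace := by
    rw [h.wordProd_eq, hΩ, smul_mul_smul, Matrix.trace_smul, smul_eq_mul]
    congr 1
    have h2 := trace_unitary_conj V⁻¹ (Ω * wordProd A w)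
    rw [← unitary_conj_mul_conj, unitary_coe_inv, Matrix.conjTranspose_conjTranspose] at h2
    exact h2
  have h0 : η * (c : ℂ) ^ L ≠ 0 := by
    refine mul_ne_zero ?_ (pow_ne_zero _ c.coe_ne_zero)
    rcases hη with rfl | rfl <;> simp
  rw [h1, Circle.coe_inv, Circle.coe_mul, Circle.coe_pow, hζ,
    inv_mul_cancel_left₀ h0]

theorem gaugeRelated_iff {c : Circle} {V : BondUnitary n} :
    GaugeRelated A A' c V ↔ ∀ i, A i * (V : BondMatrix n) =
      (c : ℂ)⁻¹ • ((V : BondMatrix n) * A' i) := by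
  refine forall_congr' fun i => ⟨fun h => ?_, fun h => ?_⟩
  · rw [h, mul_smul_comm, inv_smul_smul₀ c.coe_ne_zero, ← mul_assoc, ← mul_assoc,
      unitary_mul_conjTranspose, one_mul]
  · rw [mul_assoc, h, mul_smul_comm, smul_inv_smul₀ c.coe_ne_zero, ← mul_assoc,
      unitary_conjTranspose_mul, one_mul]

/-- Words of two consecutive lengths contain `1` in their span, so that a gauge transformation of
`A` into itself has a phase `c` with `c ^ l = c ^ (l + 1) = 1`. -/
theorem GaugeRelated.phase_eq (hn : 1 ≤ n) {u : BondMatrix n} (hu : IsWallMatrix par A u)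
    {c₁ c₂ : Circle} {V₁ V₂ : BondUnitary n} (h₁ : GaugeRelated A A' c₁ V₁)
    (h₂ : GaugeRelated A A' c₂ V₂) : c₁ = c₂ := by
  have : NeZero n := ⟨by omega⟩
  obtain ⟨l, hl⟩ := hu.exists_one_mem_paritySpan hn
  have key : ∀ a, l ≤ a → (c₁ : ℂ) ^ a = (c₂ : ℂ) ^ a := by
    intro a ha
    have h3 : ∀ X ∈ paritySpan par A a 0,
        (c₁ : ℂ) ^ a • ((V₁ : BondMatrix n)ᴴ * X * (V₁ : BondMatrix n)) =
          (c₂ : ℂ) ^ a • ((V₂ : BondMatrix n)ᴴ * X * (V₂ : BondMatrix n)) := by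
      intro X hX
      refine Submodule.span_induction ?_ (by simp) (fun X Y _ _ hx hy => ?_) (fun d X _ hx => ?_) hX
      · rintro _ ⟨w, -, rfl⟩
        rw [← h₁.wordProd_eq, ← h₂.wordProd_eq]
      · rw [mul_add, mul_add, add_mul, add_mul, smul_add, smul_add, hx, hy]
      · rw [mul_smul_comm, mul_smul_comm, smul_mul_assoc, smul_mul_assoc, smul_comm, hx, smul_comm]
    have h4 := h3 1 (hl a ha)
    rw [mul_one, mul_one, unitary_conjTranspose_mul, unitary_conjTranspose_mul] at h4
    exact smul_left_injective ℂ (one_ne_zero (α := BondMatrix n)) h4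
  have h5 := key (l + 1) (Nat.le_succ l)
  rw [pow_succ, pow_succ, key l le_rfl] at h5
  exact Circle.ext (mul_left_cancel₀ (pow_ne_zero l c₂.coe_ne_zero) h5)

/-- Two solutions of the gauge relation with the same phase differ by an element of the
commutant. -/
theorem GaugeRelated.commute_mul_inv {c : Circle} {V V₁ : BondUnitary n}
    (h : GaugeRelated A A' c V) (h₁ : GaugeRelated A A' c V₁) (i : ι) :
    Commute ((V₁ * V⁻¹ : BondUnitary n) : BondMatrix n) (A i) := by
  rw [gaugeRelated_iff] at h₁
  have h2 : (V : BondMatrix n)ᴴ * A i = (c : ℂ)⁻¹ • (A' i * (V : BondMatrix n)ᴴ) := by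
    rw [h i, smul_mul_assoc, inv_smul_smul₀ c.coe_ne_zero, mul_assoc, unitary_mul_conjTranspose,
      mul_one]
  change (V₁ : BondMatrix n) * (V : BondMatrix n)ᴴ * A i =
    A i * ((V₁ : BondMatrix n) * (V : BondMatrix n)ᴴ)
  rw [mul_assoc, h2, ← mul_assoc, h₁ i, mul_smul_comm, smul_mul_assoc, mul_assoc]

theorem GaugeRelated.iff_exists_centralUnitaries (hn : 1 ≤ n) {u u' : BondMatrix n}
    (hu : IsWallMatrix par A u) (hu' : IsWallMatrix par A' u') {c : Circle} {V : BondUnitary n}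
    (h : GaugeRelated A A' c V) (V₁ : BondUnitary n) :
    GaugeRelated A A' c V₁ ↔
      ∃ z ∈ centralUnitaries A, ∃ z' ∈ centralUnitaries A', V₁ = z * V * z' := by
  constructor
  · intro h₁
    refine ⟨V₁ * V⁻¹, (hu.mem_centralUnitaries_iff hn).2 (h.commute_mul_inv h₁), 1,
      (hu'.mem_centralUnitaries_iff hn).2 fun i => Commute.one_left _, ?_⟩
    rw [mul_one, inv_mul_cancel_right]
  · rintro ⟨z, hz, z', hz', rfl⟩
    rw [hu.mem_centralUnitaries_iff hn] at hz
    rw [hu'.mem_centralUnitaries_iff hn] at hz'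
    rw [gaugeRelated_iff] at h ⊢
    intro i
    change A i * ((z : BondMatrix n) * (V : BondMatrix n) * (z' : BondMatrix n)) =
      (c : ℂ)⁻¹ • ((z : BondMatrix n) * (V : BondMatrix n) * (z' : BondMatrix n) * A' i)
    rw [mul_assoc (_ * _), (hz' i).eq, ← mul_assoc, ← mul_assoc, ← (hz i).eq, mul_assoc _ (A i), h,
      mul_smul_comm, smul_mul_assoc]
    simp only [mul_assoc]

theorem GaugeRelated.wall_eq (hn : 1 ≤ n) {u u' : BondMatrix n}
    (hu : IsWallMatrix par A u) (hu' : IsWallMatrix par A' u') {c : Circle} {V : BondUnitary n}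
    (h : GaugeRelated A A' c V) :
    ∃ η : ℂ, (η = 1 ∨ η = -1) ∧
      u' = η • ((V : BondMatrix n)ᴴ * u * (V : BondMatrix n)) := by
  have hu'V := eq_unitary_conj V⁻¹ u'
  rw [unitary_coe_inv, Matrix.conjTranspose_conjTranspose] at hu'V
  have hcomm : ∀ i, Commute ((V : BondMatrix n) * u' * (V : BondMatrix n)ᴴ) (A i) := by
    intro i
    have h1 : A i = (c : ℂ)⁻¹ • ((V : BondMatrix n) * A' i * (V : BondMatrix n)ᴴ) := by
      rw [← smul_mul_assoc, ← gaugeRelated_iff.1 h i, mul_assoc, unitary_mul_conjTranspose, mul_one]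
    rw [h1]
    refine Commute.smul_right ?_ _
    rw [Commute, SemiconjBy, unitary_conj_mul_conj, unitary_conj_mul_conj, (hu'.commute i).eq]
  obtain hX | hX := hu.eq_or_eq_neg hn hcomm
    (by rw [unitary_conj_mul_conj, hu'.mul_self, mul_one, unitary_mul_conjTranspose])
    (by rw [trace_unitary_conj, hu'.trace_eq_zero])
  · exact ⟨1, Or.inl rfl, by rw [one_smul, ← hX]; exact hu'V⟩
  · refine ⟨-1, Or.inr rfl, ?_⟩
    rw [hX] at hu'V
    rw [hu'V]
    simp

theorem exists_wall_sign (hn : 1 ≤ n) {u u' : BondMatrix n}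
    (hu : IsWallMatrix par A u) (hu' : IsWallMatrix par A' u') :
    ∃ η : ℂ, (η = 1 ∨ η = -1) ∧ ∀ (V : BondUnitary n) (c : Circle), GaugeRelated A A' c V →
      u' = η • ((V : BondMatrix n)ᴴ * u * (V : BondMatrix n)) := by
  by_cases hex : ∃ (V : BondUnitary n) (c : Circle), GaugeRelated A A' c V
  · obtain ⟨V, c, h⟩ := hex
    obtain ⟨η, hη, hV⟩ := h.wall_eq hn hu hu'
    refine ⟨η, hη, fun V₁ c₁ h₁ => ?_⟩
    obtain rfl := h.phase_eq hn hu h₁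
    -- `V₁ V⁻¹` lies in the commutant `span {1, u}` of `A`, so it commutes with `u`
    obtain ⟨a, b, hab⟩ := hu.exists_eq_of_forall_commute hn (h.commute_mul_inv h₁)
    have hcu : Commute ((V₁ * V⁻¹ : BondUnitary n) : BondMatrix n) u := by
      rw [hab]
      exact ((Commute.one_left _).smul_left a).add_left ((Commute.refl u).smul_left b)
    obtain ⟨U, rfl⟩ : ∃ U : BondUnitary n, V₁ = U * V := ⟨V₁ * V⁻¹, by rw [inv_mul_cancel_right]⟩
    rw [mul_inv_cancel_right] at hcu
    rw [hV]
    congr 1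
    change _ = ((U : BondMatrix n) * (V : BondMatrix n))ᴴ * u *
      ((U : BondMatrix n) * (V : BondMatrix n))
    rw [Matrix.conjTranspose_mul]
    simp only [mul_assoc]
    rw [← mul_assoc u (U : BondMatrix n), ← hcu.eq, mul_assoc, ← mul_assoc (U : BondMatrix n)ᴴ,
      unitary_conjTranspose_mul, one_mul]
  · exact ⟨1, Or.inl rfl, fun V c h => absurd ⟨V, c, h⟩ hex⟩

theorem isCanonical_of_kronecker [Fintype ι] (hcA : IsCanonical A) {W : BondUnitary n}
    {B : ι → Matrix (Fin n) (Fin n) ℂ}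
    (hA : ∀ i, A i = (W : BondMatrix n) * ((pauliX ^ (par i).val) ⊗ₖ B i) * (W : BondMatrix n)ᴴ) :
    IsCanonical B := by
  have h1 : ∀ i, A i * (A i)ᴴ = (W : BondMatrix n) *
      ((1 : Matrix (Fin 2) (Fin 2) ℂ) ⊗ₖ (B i * (B i)ᴴ)) * (W : BondMatrix n)ᴴ := by
    intro i
    have h2 : (pauliX ^ (par i).val) * (pauliX ^ (par i).val)ᴴ = 1 := by
      rw [Matrix.conjTranspose_pow, pauliX_conjTranspose, pauliX_pow_val_mul, CharTwo.add_self_eq_zero]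
      simp
    have h3 : (A i)ᴴ = (W : BondMatrix n) * ((pauliX ^ (par i).val) ⊗ₖ B i)ᴴ *
        (W : BondMatrix n)ᴴ := by
      rw [hA, Matrix.conjTranspose_mul, Matrix.conjTranspose_mul, Matrix.conjTranspose_conjTranspose,
        mul_assoc]
    rw [h3, hA, unitary_conj_mul_conj, Matrix.conjTranspose_kronecker, ← Matrix.mul_kronecker_mul,
      h2]
  have h4 : (W : BondMatrix n) * ((1 : Matrix (Fin 2) (Fin 2) ℂ) ⊗ₖ (∑ i, B i * (B i)ᴴ)) *
      (W : BondMatrix n)ᴴ = (W : BondMatrix n) * 1 * (W : BondMatrix n)ᴴ := by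
    rw [mul_one, unitary_mul_conjTranspose, ← hcA]
    simp_rw [h1]
    rw [← Finset.sum_mul, ← Finset.mul_sum]
    congr 2
    ext x y
    simp [Matrix.sum_apply, Finset.mul_sum]
  have h5 := unitary_conj_injective W h4
  ext i j
  have h6 := congrFun (congrFun h5 (0, i)) (0, j)
  simpa [Matrix.kronecker_apply, Matrix.one_apply] using h6

theorem trace_wall_pow_mul_wordProd {W : BondUnitary n} {B : ι → Matrix (Fin n) (Fin n) ℂ}
    (hA : ∀ i, A i = (W : BondMatrix n) * ((pauliX ^ (par i).val) ⊗ₖ B i) * (W : BondMatrix n)ᴴ)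
    (κ : ZMod 2) {L : ℕ} (w : Fin L → ι) (hw : ∑ k, par (w k) = κ) :
    ((W : BondMatrix n) * ((pauliX ^ κ.val) ⊗ₖ (1 : Matrix (Fin n) (Fin n) ℂ)) *
      (W : BondMatrix n)ᴴ * wordProd A w).trace = 2 * (wordProd B w).trace := by
  rw [wordProd_kronecker hA, unitary_conj_mul_conj, trace_unitary_conj, ← Matrix.mul_kronecker_mul,
    pauliX_pow_val_mul, Matrix.trace_kronecker, trace_pauliX_pow_val, hw,
    CharTwo.add_self_eq_zero, if_pos rfl, one_mul]

/-- Equality of states with boundary matrices `1 = u ^ 0` (`κ = 0`) or `u` (`κ = 1`) gives a gauge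
relation. The boundary matrix selects the words of parity `κ`, to which the fundamental theorem
for one parity applies; the sign on the odd generators is a conjugation by `σ_z ⊗ 1`. -/
theorem exists_gaugeRelated_of_samePhysicalState [Fintype ι] (hn : 1 ≤ n)
    (hcA : IsCanonical A) (hcA' : IsCanonical A') {W W' : BondUnitary n}
    {B B' : ι → Matrix (Fin n) (Fin n) ℂ}
    (hA : ∀ i, A i = (W : BondMatrix n) * ((pauliX ^ (par i).val) ⊗ₖ B i) * (W : BondMatrix n)ᴴ)
    (hA' : ∀ i, A' i =
      (W' : BondMatrix n) * ((pauliX ^ (par i).val) ⊗ₖ B' i) * (W' : BondMatrix n)ᴴ)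
    {l l' : ℕ} (hspan : paritySpan par B l 0 = ⊤ ∧ paritySpan par B l 1 = ⊤)
    (hspan' : paritySpan par B' l' 0 = ⊤ ∧ paritySpan par B' l' 1 = ⊤) (κ : ZMod 2)
    (h : SamePhysicalState A
      ((W : BondMatrix n) * ((pauliX ^ κ.val) ⊗ₖ (1 : Matrix (Fin n) (Fin n) ℂ)) *
        (W : BondMatrix n)ᴴ) A'
      ((W' : BondMatrix n) * ((pauliX ^ κ.val) ⊗ₖ (1 : Matrix (Fin n) (Fin n) ℂ)) *
        (W' : BondMatrix n)ᴴ)) :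
    ∃ (V : BondUnitary n) (c : Circle), GaugeRelated A A' c V := by
  have : NeZero n := ⟨by omega⟩
  rw [samePhysicalState_iff] at h
  obtain ⟨U, r, s, hs, hU⟩ := exists_unitary_of_trace_wordProd (par := par) (M := B) (M' := B')
    (fun ε => by
      obtain rfl | rfl := zmod_two_eq_zero_or_one ε
      exacts [hspan.1, hspan.2])
    (fun ε => by
      obtain rfl | rfl := zmod_two_eq_zero_or_one ε
      exacts [hspan'.1, hspan'.2])
    (isCanonical_of_kronecker hcA hA) (isCanonical_of_kronecker hcA' hA') κ
    (fun L hL => by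
      obtain ⟨α, hα⟩ := h L hL
      refine ⟨α, fun w hw => ?_⟩
      have h1 := hα w
      rw [trace_wall_pow_mul_wordProd hA κ w hw, trace_wall_pow_mul_wordProd hA' κ w hw,
        mul_left_comm] at h1
      exact mul_left_cancel₀ two_ne_zero h1)
  obtain ⟨τ, hτ, hτh, hτX⟩ : ∃ τ : Matrix (Fin 2) (Fin 2) ℂ, τ * τ = 1 ∧ τᴴ = τ ∧
      ∀ ε : ZMod 2, τ * pauliX ^ ε.val * τ = s ^ ε.val • pauliX ^ ε.val := by
    obtain rfl | rfl := hs
    · exact ⟨1, by simp, by simp, by simp⟩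
    · refine ⟨pauliZ, pauliZ_mul_self, pauliZ_conjTranspose, fun ε => ?_⟩
      obtain rfl | rfl := zmod_two_eq_zero_or_one ε
      · simp [pauliZ_mul_self]
      · simp [ZMod.val_one, pauliZ_mul_pauliX_mul_pauliZ]
  have hT : τ ⊗ₖ (U : Matrix (Fin n) (Fin n) ℂ)ᴴ ∈ Matrix.unitaryGroup (Fin 2 × Fin n) ℂ := by
    rw [Matrix.mem_unitaryGroup_iff, Matrix.star_eq_conjTranspose, Matrix.conjTranspose_kronecker,
      hτh, Matrix.conjTranspose_conjTranspose, ← Matrix.mul_kronecker_mul, hτ,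
      unitary_conjTranspose_mul, Matrix.one_kronecker_one]
  refine ⟨W * ⟨_, hT⟩ * W'⁻¹, r, fun i => ?_⟩
  change A' i = (r : ℂ) • (((W : BondMatrix n) * (τ ⊗ₖ (U : Matrix (Fin n) (Fin n) ℂ)ᴴ) *
    (W' : BondMatrix n)ᴴ)ᴴ * A i * ((W : BondMatrix n) *
    (τ ⊗ₖ (U : Matrix (Fin n) (Fin n) ℂ)ᴴ) * (W' : BondMatrix n)ᴴ))
  have h2 : (pauliX ^ (par i).val) ⊗ₖ B' i = (r : ℂ) •
      ((τ ⊗ₖ (U : Matrix (Fin n) (Fin n) ℂ)) * ((pauliX ^ (par i).val) ⊗ₖ B i) *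
        (τ ⊗ₖ (U : Matrix (Fin n) (Fin n) ℂ)ᴴ)) := by
    rw [← Matrix.mul_kronecker_mul, ← Matrix.mul_kronecker_mul, hτX, hU, Matrix.smul_kronecker,
      Matrix.kronecker_smul, mul_smul]
  rw [hA', h2, hA, Matrix.conjTranspose_mul, Matrix.conjTranspose_mul,
    Matrix.conjTranspose_conjTranspose, Matrix.conjTranspose_kronecker, hτh,
    Matrix.conjTranspose_conjTranspose, mul_smul_comm, smul_mul_assoc]
  congr 1
  simp only [mul_assoc]
  rw [← mul_assoc (W : BondMatrix n)ᴴ (W : BondMatrix n), unitary_conjTranspose_mul, one_mul,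
    ← mul_assoc (W : BondMatrix n)ᴴ (W : BondMatrix n), unitary_conjTranspose_mul, one_mul]

end Gauge

end FMPS

theorem theorem3 {ι : Type*} [Fintype ι] (par : ι → ZMod 2) (n : ℕ) (hn : 1 ≤ n)
    (A A' : ι → FMPS.BondMatrix n)
    (hA : FMPS.IsInjectiveMinus par A) (hA' : FMPS.IsInjectiveMinus par A')
    (hcA : FMPS.IsCanonical A) (hcA' : FMPS.IsCanonical A') :
    -- equal physical states under antiperiodic boundary conditions
    (FMPS.EquivAPBC A A' ↔
      ∃ (V : FMPS.BondUnitary n) (c : Circle), FMPS.GaugeRelated A A' c V) ∧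
    -- equal physical states under periodic boundary conditions, for any choice of Wall matrices
    (∀ u u' : FMPS.BondMatrix n, FMPS.IsWallMatrix par A u → FMPS.IsWallMatrix par A' u' →
      (FMPS.EquivPBC A A' u u' ↔
        ∃ (V : FMPS.BondUnitary n) (c : Circle), FMPS.GaugeRelated A A' c V)) ∧
    -- the phase is unique
    (∀ (V₁ V₂ : FMPS.BondUnitary n) (c₁ c₂ : Circle),
      FMPS.GaugeRelated A A' c₁ V₁ → FMPS.GaugeRelated A A' c₂ V₂ → c₁ = c₂) ∧
    -- the unitary is unique exactly up to central unitaries of the two algebras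
    (∀ (V : FMPS.BondUnitary n) (c : Circle), FMPS.GaugeRelated A A' c V →
      ∀ V₁ : FMPS.BondUnitary n, FMPS.GaugeRelated A A' c V₁ ↔
        ∃ z ∈ FMPS.centralUnitaries A, ∃ z' ∈ FMPS.centralUnitaries A', V₁ = z * V * z') ∧
    -- the central unitaries are the matrices `e^{iα} e^{iθu}`
    (∀ u : FMPS.BondMatrix n, FMPS.IsWallMatrix par A u →
      ∀ z : FMPS.BondMatrix n, (∃ y ∈ FMPS.centralUnitaries A, (y : FMPS.BondMatrix n) = z) ↔
        ∃ α θ : ℝ, z = FMPS.phaseExp α θ u) ∧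
    (∀ u' : FMPS.BondMatrix n, FMPS.IsWallMatrix par A' u' →
      ∀ z : FMPS.BondMatrix n, (∃ y ∈ FMPS.centralUnitaries A', (y : FMPS.BondMatrix n) = z) ↔
        ∃ α θ : ℝ, z = FMPS.phaseExp α θ u') ∧
    -- the Wall matrices are related by one sign, the same for all solutions `V`
    (∀ u u' : FMPS.BondMatrix n, FMPS.IsWallMatrix par A u → FMPS.IsWallMatrix par A' u' →
      ∃ η : ℂ, (η = 1 ∨ η = -1) ∧
        ∀ (V : FMPS.BondUnitary n) (c : Circle), FMPS.GaugeRelated A A' c V →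
          u' = η • ((V : FMPS.BondMatrix n)ᴴ * u * (V : FMPS.BondMatrix n))) := by
  obtain ⟨-, u₀, hu₀⟩ := hA
  obtain ⟨-, u₀', hu₀'⟩ := hA'
  refine ⟨⟨fun h => ?_, fun ⟨V, c, h⟩ => ?_⟩, fun u u' hu hu' => ⟨fun h => ?_, fun ⟨V, c, h⟩ => ?_⟩,
    fun V₁ V₂ c₁ c₂ h₁ h₂ => h₁.phase_eq hn hu₀ h₂,
    fun V c h V₁ => h.iff_exists_centralUnitaries hn hu₀ hu₀' V₁,
    fun u hu z => hu.exists_centralUnitaries_iff hn z,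
    fun u' hu' z => hu'.exists_centralUnitaries_iff hn z,
    fun u u' hu hu' => FMPS.exists_wall_sign hn hu hu'⟩
  · obtain ⟨W, -, B, hB, l, hl⟩ := hu₀
    obtain ⟨W', -, B', hB', l', hl'⟩ := hu₀'
    refine FMPS.exists_gaugeRelated_of_samePhysicalState hn hcA hcA' hB hB' hl hl' 0 ?_
    simpa [FMPS.unitary_mul_conjTranspose, FMPS.EquivAPBC] using h
  · exact h.samePhysicalState (Or.inl rfl) (by
      rw [one_smul, mul_one, FMPS.unitary_conjTranspose_mul])
  · obtain ⟨W, rfl, B, hB, l, hl⟩ := hu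
    obtain ⟨W', rfl, B', hB', l', hl'⟩ := hu'
    refine FMPS.exists_gaugeRelated_of_samePhysicalState hn hcA hcA' hB hB' hl hl' 1 ?_
    rw [ZMod.val_one, pow_one]
    exact h
  · obtain ⟨η, hη, hV⟩ := h.wall_eq hn hu hu'
    exact h.samePhysicalState hη hV
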